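/- For $\alpha>0$ and $0<p\le\infty$, let $L^p_\alpha$ denote the set of all Lebesgue measurable functions $g:\mathbb C\to\mathbb C$ such that the function $g(z)e^{-\alpha|z|^2/2}$ belongs to $L^p(\mathbb C,dA)$, where $dA$ is ordinary area measure on $\mathbb C$, and let $F^p_\alpha$ denote the Fock space of all entire functions on $\mathbb C$ that belong to $L^p_\alpha$. Theorem 11. Suppose $f$ is an entire function on $\mathbb C$, $N$ is a positive integer, $\alpha>0$, and $0<p\le\infty$. Then $f\in F^p_\alpha$ if and only if the function $f^{(N)}(z)/(1+|z|)^N$ belongs to $L^p_\alpha$. -/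

import Mathlib

open MeasureTheory
open scoped ENNReal

/-- The space `L^p_α` on the complex plane: the (Lebesgue measurable) functions `f` for which
`f(z) e^{-α|z|²/2}` belongs to `L^p` with respect to area measure. `MemLp` asks for a.e. strong
measurability, which on `ℂ` is Lebesgue measurability, together with a finite `L^p` (quasi-)norm,
the essential supremum when `p = ∞`. -/
def weightedLp (p : ℝ≥0∞) (α : ℝ) : Set (ℂ → ℂ) :=
  {f | MemLp (fun z : ℂ => f z * ((Real.exp (-(α * ‖z‖ ^ 2 / 2)) : ℝ) : ℂ)) p volume}

/-- The space `H(ℂ)` of entire functions. -/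
def entireFunctions : Set (ℂ → ℂ) :=
  {f | Differentiable ℂ f}

/-- The Fock space `F^p_α = L^p_α ∩ H(ℂ)`. -/
def fockSpace (p : ℝ≥0∞) (α : ℝ) : Set (ℂ → ℂ) :=
  weightedLp p α ∩ entireFunctions

/-! With w_k = e^{-α|z|²/2}/(1+|z|)^k, induction on N reduces the theorem to one step: g w_k ∈ L^p
iff g' w_{k+1} ∈ L^p. The natural scale is 1/(1+|z|): on such discs w_k is constant up to a factor,
and subharmonicity of |g|^p, valid for every p > 0, bounds the local supremum of |g| w_k by a
function A in L^p (`exists_memLp_local_bound`). Cauchy's estimate on these discs bounds g'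
(`memLp_deriv_of_memLp`). Conversely, move z radially to z' with |z'|² = |z|² - 1/2. This preserves
area, moves z by at most 1/(1+|z|), and gains a factor e^{-α/4} from the weight. The mean value
inequality then gives F(z) ≤ q F(z') + A(z) for F = |g| w_k and q = e^{-α/4} < 1, and the first term
is absorbed after integration (`memLp_of_le_radialShift`). -/

/-! ### Sub-mean value properties -/

/-- A form of Jensen's inequality: `log ‖g‖` is subharmonic. -/
lemma log_norm_le_circleAverage {g : ℂ → ℂ} (hg : Differentiable ℂ g) (h0 : g 0 ≠ 0) :
    Real.log ‖g 0‖ ≤ Real.circleAverage (fun z => Real.log ‖g z‖) 0 1 := by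
  have ha : AnalyticOnNhd ℂ g (Metric.closedBall 0 |1|) := fun z _ => hg.analyticAt z
  rw [AnalyticOnNhd.circleAverage_log_norm one_ne_zero ha h0]
  have : 0 ≤ ∑ᶠ u, (MeromorphicOn.divisor g (Metric.closedBall 0 |1|) u : ℝ) *
      Real.log (1 * ‖(0 : ℂ) - u‖⁻¹) := by
    refine finsum_nonneg fun u => ?_
    by_cases hu : u ∈ Metric.closedBall (0 : ℂ) |1|
    · refine mul_nonneg ?_ ?_
      · exact_mod_cast MeromorphicOn.AnalyticOnNhd.divisor_nonneg ha u
      · rcases eq_or_ne u 0 with rfl | hu0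
        · simp
        · simp only [abs_one, mem_closedBall_zero_iff] at hu
          refine Real.log_nonneg ?_
          rw [zero_sub, norm_neg, one_mul]
          exact (one_le_inv₀ (norm_pos_iff.2 hu0)).2 hu
    · rw [Function.locallyFinsuppWithin.apply_eq_zero_of_notMem _ hu]
      simp
  linarith

/-- The sub-mean value property of `‖g‖ ^ p` for entire `g` and arbitrary `p > 0`. -/
lemma norm_rpow_le_circleAverage {g : ℂ → ℂ} (hg : Differentiable ℂ g) {p : ℝ} (hp : 0 < p) :
    ‖g 0‖ ^ p ≤ Real.circleAverage (fun z => ‖g z‖ ^ p) 0 1 := by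
  by_cases h0 : g 0 = 0
  · rw [h0, norm_zero, Real.zero_rpow hp.ne']
    exact Real.circleAverage_nonneg_of_nonneg fun z _ => by positivity
  have hlog := log_norm_le_circleAverage hg h0
  set m := Real.circleAverage (fun z => Real.log ‖g z‖) 0 1 with hm
  have hlogint : CircleIntegrable (fun z => Real.log ‖g z‖) 0 1 :=
    MeromorphicOn.circleIntegrable_log_norm fun z _ => (hg.analyticAt z).meromorphicAt
  -- Jensen's inequality for exp by hand: `T` is the tangent line of exp at p·m, evaluated at p
  -- log‖g‖.
  let T : ℂ → ℝ := fun z => Real.exp (p * m) * (1 - p * m) + (Real.exp (p * m) * p) *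
    Real.log ‖g z‖
  have hTint : CircleIntegrable T 0 1 :=
    (circleIntegrable_const _ _ _).add (hlogint.const_mul _)
  have hT : Real.circleAverage T 0 1 = Real.exp (p * m) := by
    have : T = (fun _ => Real.exp (p * m) * (1 - p * m)) +
        (Real.exp (p * m) * p) • (fun z => Real.log ‖g z‖) := by
      ext z; simp [T]
    have hint : CircleIntegrable ((Real.exp (p * m) * p) • (fun z => Real.log ‖g z‖)) 0 1 :=
      hlogint.const_mul _
    rw [this, Real.circleAverage_add (circleIntegrable_const _ _ _) hint,
      Real.circleAverage_const, Real.circleAverage_smul, ← hm, smul_eq_mul]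
    ring
  -- Since `Real.log 0 = 0`, `T` may exceed ‖g‖^p at a zero of g. Zeros are isolated, so resetting
  -- the value there leaves the average unchanged.
  let T' : ℂ → ℝ := fun z => if g z = 0 then 0 else T z
  have hcod : T =ᶠ[Filter.codiscreteWithin (Metric.sphere (0 : ℂ) |1|)] T' := by
    have han : AnalyticOnNhd ℂ g Set.univ := fun z _ => hg.analyticAt z
    have := AnalyticOnNhd.preimage_zero_mem_codiscrete han h0
    have := Filter.codiscreteWithin_mono (Set.subset_univ (Metric.sphere (0 : ℂ) |1|)) this
    filter_upwards [this] with z hz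
    have hz' : g z ≠ 0 := hz
    simp [T', hz']
  have hT'int : CircleIntegrable T' 0 1 := hTint.congr_codiscreteWithin hcod
  have hcont : Continuous fun z => ‖g z‖ ^ p :=
    hg.continuous.norm.rpow_const fun _ => Or.inr hp.le
  have hle : Real.circleAverage T' 0 1 ≤ Real.circleAverage (fun z => ‖g z‖ ^ p) 0 1 := by
    refine Real.circleAverage_mono hT'int (hcont.continuousOn.circleIntegrable zero_le_one) ?_
    intro z _
    simp only [T']
    split_ifs with hz
    · positivity
    · have h1 := Real.add_one_le_exp (p * Real.log ‖g z‖ - p * m)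
      have h2 : ‖g z‖ ^ p = Real.exp (p * m) * Real.exp (p * Real.log ‖g z‖ - p * m) := by
        rw [← Real.exp_add, Real.rpow_def_of_pos (norm_pos_iff.2 hz)]
        congr 1; ring
      rw [h2]
      have := mul_le_mul_of_nonneg_left h1 (Real.exp_pos (p * m)).le
      simp only [T]
      linarith
  rw [← Real.circleAverage_congr_codiscreteWithin hcod one_ne_zero, hT] at hle
  refine le_trans ?_ hle
  rw [Real.rpow_def_of_pos (norm_pos_iff.2 h0)]
  exact Real.exp_le_exp.2 (by nlinarith)

lemma ofReal_norm_rpow_le_lintegral_circle {g : ℂ → ℂ} (hg : Differentiable ℂ g) {p : ℝ}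
    (hp : 0 < p) :
    ENNReal.ofReal (2 * Real.pi) * ENNReal.ofReal (‖g 0‖ ^ p) ≤
      ∫⁻ θ in Set.Ioc 0 (2 * Real.pi), ENNReal.ofReal (‖g (Circle.exp θ)‖ ^ p) := by
  have hpi := Real.pi_pos
  have hcont : Continuous fun θ : ℝ => ‖g (Circle.exp θ)‖ ^ p :=
    (hg.continuous.comp (by fun_prop)).norm.rpow_const fun _ => Or.inr hp.le
  have h := norm_rpow_le_circleAverage hg hp
  rw [Real.circleAverage_def, intervalIntegral.integral_of_le (by positivity), smul_eq_mul,
    le_inv_mul_iff₀ (by positivity)] at h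
  rw [← ENNReal.ofReal_mul (by positivity), ← ofReal_integral_eq_lintegral_ofReal]
  · refine ENNReal.ofReal_le_ofReal (h.trans_eq ?_)
    simp [circleMap]
  · exact (hcont.integrableOn_Icc (a := 0) (b := 2 * Real.pi)).mono_set Set.Ioc_subset_Icc_self
  · exact Filter.Eventually.of_forall fun θ => by positivity

/-- The area form of the sub-mean value property of `‖g‖ ^ p`. -/
lemma volume_ball_mul_norm_rpow_le {g : ℂ → ℂ} (hg : Differentiable ℂ g) {p : ℝ}
    (hp : 0 < p) (c : ℂ) (r : ℝ) :
    volume (Metric.ball c r) * ENNReal.ofReal (‖g c‖ ^ p) ≤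
      ∫⁻ z in Metric.ball c r, ENNReal.ofReal (‖g z‖ ^ p) := by
  have hpi := Real.pi_pos
  have hcont : Continuous fun z => ‖g (c + z)‖ ^ p :=
    (hg.continuous.comp (by fun_prop)).norm.rpow_const fun _ => Or.inr hp.le
  set H : ℂ → ℝ≥0∞ := fun z => ENNReal.ofReal (‖g (c + z)‖ ^ p) with hH
  have hHm : Measurable H := (ENNReal.continuous_ofReal.comp hcont).measurable
  have htrans : ∫⁻ z in Metric.ball c r, ENNReal.ofReal (‖g z‖ ^ p) =
      ∫⁻ z in Metric.ball 0 r, H z := by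
    have := (measurePreserving_add_left volume c).setLIntegral_comp_preimage_emb
      (MeasurableEquiv.addLeft c).measurableEmbedding
      (fun z => ENNReal.ofReal (‖g z‖ ^ p)) (Metric.ball c r)
    rw [← this]
    congr 2
    ext z; simp
  have hrot : ∀ θ : ℝ, ∫⁻ z in Metric.ball 0 r, H (Circle.exp θ * z) =
      ∫⁻ z in Metric.ball 0 r, H z := by
    intro θ
    have := (rotation (Circle.exp θ)).measurePreserving.setLIntegral_comp_preimage_emb
      (rotation (Circle.exp θ)).toMeasurableEquiv.measurableEmbedding H (Metric.ball 0 r)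
    rw [← this, LinearIsometryEquiv.preimage_ball, map_zero]
    simp only [rotation_apply]
  have hvol : volume (Metric.ball c r) = volume (Metric.ball (0 : ℂ) r) := by
    simp [Complex.volume_ball]
  have hjoint : Measurable fun x : ℝ × ℂ => H (Circle.exp x.1 * x.2) :=
    hHm.comp (Continuous.measurable (by fun_prop))
  -- Apply the circle inequality to w ↦ g(c + wz) for each z, integrate over z and swap: by rotation
  -- invariance the inner integral does not depend on θ.
  have key : volume (Metric.ball (0 : ℂ) r) *
        (ENNReal.ofReal (2 * Real.pi) * ENNReal.ofReal (‖g c‖ ^ p)) ≤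
      ENNReal.ofReal (2 * Real.pi) * ∫⁻ z in Metric.ball 0 r, H z := by
    calc _ = ∫⁻ z in Metric.ball (0 : ℂ) r,
          ENNReal.ofReal (2 * Real.pi) * ENNReal.ofReal (‖g c‖ ^ p) := by
            rw [setLIntegral_const, mul_comm]
      _ ≤ ∫⁻ z in Metric.ball (0 : ℂ) r, ∫⁻ θ in Set.Ioc 0 (2 * Real.pi),
          H (Circle.exp θ * z) := by
            refine lintegral_mono fun z => ?_
            have := ofReal_norm_rpow_le_lintegral_circle (g := fun w => g (c + w * z))
              (by fun_prop) hp
            simpa using this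
      _ = ∫⁻ θ in Set.Ioc 0 (2 * Real.pi), ∫⁻ z in Metric.ball (0 : ℂ) r,
          H (Circle.exp θ * z) :=
            lintegral_lintegral_swap (hjoint.comp measurable_swap).aemeasurable
      _ = _ := by
            simp only [hrot]
            rw [setLIntegral_const, Real.volume_Ioc, sub_zero, mul_comm]
  rw [htrans, hvol]
  have h2 : ENNReal.ofReal (2 * Real.pi) ≠ 0 := by simp [hpi]
  refine (ENNReal.mul_le_mul_iff_right h2 ENNReal.ofReal_ne_top).1 ?_
  refine le_trans (le_of_eq ?_) key
  ring

/-! ### The area-preserving radial shift -/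

/-- Moves `z` towards the origin so that `‖z‖ ^ 2` decreases by `1 / 2`. -/
noncomputable def radialShift (z : ℂ) : ℂ := ((√(‖z‖ ^ 2 - 1 / 2) / ‖z‖ : ℝ) : ℂ) * z

lemma norm_radialShift {z : ℂ} (hz : 1 ≤ ‖z‖) : ‖radialShift z‖ = √(‖z‖ ^ 2 - 1 / 2) := by
  have : ‖z‖ ≠ 0 := by positivity
  rw [radialShift, norm_mul, Complex.norm_real, Real.norm_of_nonneg (by positivity)]
  field_simp

lemma norm_radialShift_sq {z : ℂ} (hz : 1 ≤ ‖z‖) : ‖radialShift z‖ ^ 2 = ‖z‖ ^ 2 - 1 / 2 := by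
  rw [norm_radialShift hz, Real.sq_sqrt (by nlinarith)]

lemma norm_radialShift_le {z : ℂ} (hz : 1 ≤ ‖z‖) : ‖radialShift z‖ ≤ ‖z‖ := by
  have := norm_radialShift_sq hz
  nlinarith [norm_nonneg (radialShift z), norm_nonneg z]

/-- The displacement is |z| - |z'| = (1/2)/(|z| + |z'|) ≤ 1/(2|z|), and 2|z| ≥ 1 + |z|. -/
lemma norm_radialShift_sub_le {z : ℂ} (hz : 1 ≤ ‖z‖) :
    ‖radialShift z - z‖ ≤ 1 / (1 + ‖z‖) := by
  have hle := norm_radialShift_le hz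
  have hsq := norm_radialShift_sq hz
  have hz0 : ‖z‖ ≠ 0 := by positivity
  have h1 : radialShift z - z = (((‖radialShift z‖ - ‖z‖) / ‖z‖ : ℝ) : ℂ) * z := by
    rw [norm_radialShift hz, radialShift, sub_div, div_self hz0]
    push_cast; ring
  have h2 : ‖radialShift z - z‖ = ‖z‖ - ‖radialShift z‖ := by
    rw [h1, norm_mul, Complex.norm_real, Real.norm_of_nonpos
      (div_nonpos_of_nonpos_of_nonneg (by linarith) (norm_nonneg _))]
    field_simp; ring
  rw [h2, le_div_iff₀ (by positivity)]
  nlinarith [norm_nonneg (radialShift z)]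

lemma measurable_radialShift : Measurable radialShift := by
  unfold radialShift
  fun_prop

/-- `radialShift` preserves area. -/
lemma lintegral_comp_radialShift_le {h : ℂ → ℝ≥0∞} (hh : Measurable h) :
    ∫⁻ z in {z : ℂ | 1 ≤ ‖z‖}, h (radialShift z) ≤ ∫⁻ z, h z := by
  have hset : MeasurableSet {z : ℂ | 1 ≤ ‖z‖} :=
    measurableSet_le measurable_const measurable_norm
  have hpolar : ∀ k : ℂ → ℝ≥0∞, Measurable k → ∫⁻ z, k z =
      ∫⁻ θ in Set.Ioo (-Real.pi) Real.pi, ∫⁻ r in Set.Ioi (0 : ℝ),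
        ENNReal.ofReal r * k (Complex.polarCoord.symm (r, θ)) := by
    intro k hk
    rw [← Complex.lintegral_comp_polarCoord_symm, polarCoord_target, Measure.volume_eq_prod,
      ← Measure.prod_restrict, lintegral_prod_symm]
    · rfl
    · refine Measurable.aemeasurable ?_
      simp only [Complex.polarCoord_symm_apply]
      exact (by fun_prop : Measurable fun x : ℝ × ℝ => ENNReal.ofReal x.1).smul
        (hk.comp (by fun_prop))
  have hm : Measurable fun z => h (radialShift z) := hh.comp measurable_radialShift
  rw [← lintegral_indicator hset, hpolar _ (hm.indicator hset),
    hpolar h hh]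
  refine lintegral_mono fun θ => ?_
  -- The shift is r ↦ φ(r) in polar coordinates, and φ φ' = r says that r dr is preserved.
  let φ : ℝ → ℝ := fun r => √(r ^ 2 - 1 / 2)
  let G : ℝ → ℝ≥0∞ := fun r => ENNReal.ofReal r * h (Complex.polarCoord.symm (r, θ))
  have hpos : ∀ r ∈ Set.Ici (1 : ℝ), 0 < r ^ 2 - 1 / 2 := fun r hr => by
    have : (1 : ℝ) ≤ r := hr
    nlinarith
  have hderiv : ∀ r ∈ Set.Ici (1 : ℝ), HasDerivWithinAt φ (r / φ r) (Set.Ici 1) r := by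
    intro r hr
    have h1 : HasDerivAt (fun r : ℝ => r ^ 2 - 1 / 2) (2 * r) r := by
      simpa using (hasDerivAt_pow 2 r).sub_const (1 / 2 : ℝ)
    have h2 := (h1.sqrt (hpos r hr).ne').hasDerivWithinAt (s := Set.Ici 1)
    have h3 : (2 * r) / (2 * √(r ^ 2 - 1 / 2)) = r / φ r :=
      mul_div_mul_left _ _ two_ne_zero
    rwa [h3] at h2
  have hinj : Set.InjOn φ (Set.Ici 1) := by
    intro r hr s hs hrs
    have h1 := (Real.sqrt_inj (hpos r hr).le (hpos s hs).le).1 hrs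
    have hr' : (1 : ℝ) ≤ r := hr
    have hs' : (1 : ℝ) ≤ s := hs
    nlinarith
  have himg := lintegral_image_eq_lintegral_abs_deriv_mul measurableSet_Ici hderiv hinj G
  calc _ = ∫⁻ r in Set.Ici (1 : ℝ), ENNReal.ofReal |r / φ r| * G (φ r) := by
        rw [← lintegral_indicator measurableSet_Ioi, ← lintegral_indicator measurableSet_Ici]
        refine lintegral_congr fun r => ?_
        by_cases hr : (1 : ℝ) ≤ r
        · have hr0 : (0 : ℝ) < r := by linarith
          have hφ : 0 < φ r := Real.sqrt_pos.2 (hpos r hr)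
          have hn : ‖Complex.polarCoord.symm (r, θ)‖ = r := by
            rw [Complex.norm_polarCoord_symm, abs_of_pos hr0]
          rw [Set.indicator_of_mem (Set.mem_Ioi.2 hr0), Set.indicator_of_mem (Set.mem_Ici.2 hr),
            Set.indicator_of_mem (by rw [Set.mem_ofPred_eq, hn]; exact hr)]
          have hshift : radialShift (Complex.polarCoord.symm (r, θ)) =
              Complex.polarCoord.symm (φ r, θ) := by
            rw [radialShift, hn, Complex.polarCoord_symm_apply, Complex.polarCoord_symm_apply]
            have : (r : ℂ) ≠ 0 := by exact_mod_cast hr0.ne'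
            simp only [φ]
            push_cast
            field_simp
          simp only [G, hshift]
          rw [← mul_assoc, ← ENNReal.ofReal_mul (by positivity), abs_of_pos (by positivity),
            div_mul_cancel₀ _ hφ.ne']
        · rw [Set.indicator_of_notMem (s := Set.Ici 1) (by simpa using hr)]
          by_cases hr0 : 0 < r
          · rw [Set.indicator_of_mem (Set.mem_Ioi.2 hr0), Set.indicator_of_notMem, mul_zero]
            rw [Set.mem_ofPred_eq, Complex.norm_polarCoord_symm, abs_of_pos hr0]
            exact hr
          · rw [Set.indicator_of_notMem (by simpa using hr0)]
    _ = ∫⁻ r in φ '' Set.Ici 1, G r := himg.symm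
    _ ≤ ∫⁻ r in Set.Ioi 0, G r := by
        refine lintegral_mono_set ?_
        rintro _ ⟨r, hr, rfl⟩
        exact Real.sqrt_pos.2 (hpos r hr)

/-! ### The weights -/

/-- The weight `e^{-α|z|²/2} / (1 + |z|) ^ k`. -/
noncomputable def fockWeight (α : ℝ) (k : ℕ) (z : ℂ) : ℝ :=
  Real.exp (-(α * ‖z‖ ^ 2 / 2)) / (1 + ‖z‖) ^ k

lemma fockWeight_pos (α : ℝ) (k : ℕ) (z : ℂ) : 0 < fockWeight α k z := by
  unfold fockWeight; positivity

lemma continuous_fockWeight (α : ℝ) (k : ℕ) : Continuous (fockWeight α k) := by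
  unfold fockWeight
  exact Continuous.div (by fun_prop) (by fun_prop) fun z => by positivity

lemma fockWeight_succ (α : ℝ) (k : ℕ) (z : ℂ) :
    fockWeight α (k + 1) z = fockWeight α k z / (1 + ‖z‖) := by
  simp only [fockWeight, pow_succ, div_div]

lemma fockWeight_anti {α : ℝ} (hα : 0 < α) (k : ℕ) {z w : ℂ} (h : ‖w‖ ≤ ‖z‖) :
    fockWeight α k z ≤ fockWeight α k w := by
  unfold fockWeight
  gcongr

/-- Source of the contraction: lowering |z|² by 1/2 multiplies the Gaussian by e^{α/4}, and the
denominator does not grow. -/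
lemma fockWeight_le_radialShift {α : ℝ} (k : ℕ) {z : ℂ} (hz : 1 ≤ ‖z‖) :
    fockWeight α k z ≤ Real.exp (-(α / 4)) * fockWeight α k (radialShift z) := by
  have h := norm_radialShift_le hz
  unfold fockWeight
  rw [← mul_div_assoc, ← Real.exp_add, norm_radialShift_sq hz]
  have : -(α / 4) + -(α * (‖z‖ ^ 2 - 1 / 2) / 2) = -(α * ‖z‖ ^ 2 / 2) := by ring
  rw [this]
  gcongr

lemma one_add_norm_le_three_mul {z u : ℂ} (h : ‖u - z‖ ≤ 2 / (1 + ‖z‖)) :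
    1 + ‖u‖ ≤ 3 * (1 + ‖z‖) ∧ 1 + ‖z‖ ≤ 3 * (1 + ‖u‖) := by
  have hz := norm_nonneg z
  have hu := norm_nonneg u
  have h2 : 2 / (1 + ‖z‖) ≤ 2 := div_le_self (by norm_num) (by linarith)
  have h3 := abs_le.1 (abs_norm_sub_norm_le u z)
  constructor <;> linarith [h3.1, h3.2]

/-- The weight is essentially constant on discs of radius comparable to `1 / (1 + |z|)`. -/
lemma fockWeight_comparable {α : ℝ} (hα : 0 < α) (k : ℕ) :
    ∃ C : ℝ, 0 < C ∧ ∀ z u w : ℂ, ‖u - z‖ ≤ 2 / (1 + ‖z‖) → ‖w - z‖ ≤ 2 / (1 + ‖z‖) →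
      fockWeight α k w ≤ C * fockWeight α k u := by
  -- |u|² and |w|² each differ from |z|² by at most 8, hence from each other by 16; the 9 is 3 · 3,
  -- comparing through z.
  refine ⟨Real.exp (8 * α) * 9 ^ k, by positivity, fun z u w hu hw => ?_⟩
  have hsq : ∀ v : ℂ, ‖v - z‖ ≤ 2 / (1 + ‖z‖) → |‖v‖ ^ 2 - ‖z‖ ^ 2| ≤ 8 := by
    intro v hv
    have hz := norm_nonneg z
    have hv0 := norm_nonneg v
    have h3 := (abs_norm_sub_norm_le v z).trans hv
    have h4 : ‖v‖ + ‖z‖ ≤ 4 * (1 + ‖z‖) := by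
      have := (one_add_norm_le_three_mul hv).1
      linarith
    rw [sq_sub_sq, abs_mul, abs_of_nonneg (by positivity : 0 ≤ ‖v‖ + ‖z‖)]
    calc (‖v‖ + ‖z‖) * |‖v‖ - ‖z‖| ≤ (4 * (1 + ‖z‖)) * (2 / (1 + ‖z‖)) := by gcongr
      _ = 8 := by field_simp; norm_num
  have h1 := abs_le.1 (hsq u hu)
  have h2 := abs_le.1 (hsq w hw)
  have h9 : 1 + ‖u‖ ≤ 9 * (1 + ‖w‖) := by
    linarith [(one_add_norm_le_three_mul hu).1, (one_add_norm_le_three_mul hw).2]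
  unfold fockWeight
  rw [mul_div_assoc', div_le_div_iff₀ (by positivity) (by positivity)]
  calc _ ≤ Real.exp (8 * α + -(α * ‖u‖ ^ 2 / 2)) * (9 * (1 + ‖w‖)) ^ k := by
        gcongr
        nlinarith [h1.1, h1.2, h2.1, h2.2]
    _ = _ := by rw [Real.exp_add, mul_pow]; ring

/-! ### Local maximal bounds in L^p -/

/-- The local maximal function of a weighted entire function is dominated by a function with
finite `L^p` norm, for finite `p`. -/
lemma exists_lintegral_local_bound {α : ℝ} (hα : 0 < α) (k : ℕ) {p : ℝ} (hp : 0 < p)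
    {g : ℂ → ℂ} (hg : Differentiable ℂ g)
    (hfin : ∫⁻ z, ENNReal.ofReal ((‖g z‖ * fockWeight α k z) ^ p) ≠ ∞) :
    ∃ A : ℂ → ℝ≥0∞, Measurable A ∧ ∫⁻ z, A z ≠ ∞ ∧ (∀ z, A z ≠ ∞) ∧
      ∀ z w, ‖w - z‖ ≤ 1 / (1 + ‖z‖) →
        ENNReal.ofReal ((‖g w‖ * fockWeight α k w) ^ p) ≤ A z := by
  obtain ⟨C, hC, hcomp⟩ := fockWeight_comparable hα k
  have hcont : Continuous fun z => (‖g z‖ * fockWeight α k z) ^ p :=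
    (hg.continuous.norm.mul (continuous_fockWeight α k)).rpow_const fun _ => Or.inr hp.le
  set G : ℂ → ℝ≥0∞ := fun z => ENNReal.ofReal ((‖g z‖ * fockWeight α k z) ^ p) with hG
  have hGm : Measurable G := (ENNReal.continuous_ofReal.comp hcont).measurable
  let S : Set (ℂ × ℂ) := {x | ‖x.2 - x.1‖ < 2 / (1 + ‖x.1‖)}
  have hS : MeasurableSet S := measurableSet_lt (by fun_prop) (by fun_prop)
  have hpi := Real.pi_pos
  let c : ℂ → ℝ≥0∞ := fun z => ENNReal.ofReal (C ^ p * ((1 + ‖z‖) ^ 2 / Real.pi))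
  have hc : Measurable c := by fun_prop
  -- The dominating function is C^p times the integral of `G` over the disc of radius 2/(1+|z|),
  -- divided by the area of the disc of half that radius.
  let K : ℂ → ℂ → ℝ≥0∞ := fun z u => c z * S.indicator (fun x => G x.2) (z, u)
  have hK : Measurable (Function.uncurry K) := by
    have h1 : Measurable (S.indicator fun x : ℂ × ℂ => G x.2) :=
      (hGm.comp measurable_snd).indicator hS
    exact (hc.comp measurable_fst).mul h1
  have hKball : ∀ z, ∫⁻ u, K z u = c z * ∫⁻ u in Metric.ball z (2 / (1 + ‖z‖)), G u := by
    intro z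
    rw [← lintegral_indicator measurableSet_ball, ← lintegral_const_mul _
      (hGm.indicator measurableSet_ball)]
    refine lintegral_congr fun u => ?_
    simp only [K, S, Set.indicator, Set.mem_ofPred_eq, Metric.mem_ball, dist_eq_norm]
  refine ⟨fun z => ∫⁻ u, K z u, hK.lintegral_prod_right', ?_, ?_, ?_⟩
  · rw [lintegral_lintegral_swap hK.aemeasurable]
    -- For fixed u, the relevant z lie within 6/(1+|u|) of u and (1+|z|)² ≤ 9(1+|u|)², so the
    -- constant is 36 · 9 = 324.
    have hbd : ∀ u, ∫⁻ z, K z u ≤ ENNReal.ofReal (C ^ p * 324) * G u := by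
      intro u
      have hu := norm_nonneg u
      calc ∫⁻ z, K z u ≤ ∫⁻ z, (Metric.ball u (6 / (1 + ‖u‖))).indicator
            (fun _ => ENNReal.ofReal (C ^ p * (9 * (1 + ‖u‖) ^ 2 / Real.pi)) * G u) z := by
            refine lintegral_mono fun z => ?_
            simp only [K]
            by_cases hzu : (z, u) ∈ S
            · have hlt : ‖u - z‖ < 2 / (1 + ‖z‖) := hzu
              have hz := norm_nonneg z
              have h3 := one_add_norm_le_three_mul hlt.le
              rw [Set.indicator_of_mem hzu, Set.indicator_of_mem]
              · simp only [c]
                gcongr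
                nlinarith [h3.2]
              · rw [Metric.mem_ball, dist_comm, dist_eq_norm]
                refine hlt.trans_le ?_
                rw [div_le_div_iff₀ (by positivity) (by positivity)]
                linarith [h3.1]
            · rw [Set.indicator_of_notMem hzu, mul_zero]
              exact zero_le
        _ = ENNReal.ofReal (C ^ p * 324) * G u := by
            rw [lintegral_indicator_const measurableSet_ball, Complex.volume_ball]
            have : (NNReal.pi : ℝ≥0∞) = ENNReal.ofReal Real.pi := by
              rw [ENNReal.ofReal, ← NNReal.coe_real_pi, Real.toNNReal_coe]
            rw [this, mul_right_comm, ← ENNReal.ofReal_pow (by positivity),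
              ← ENNReal.ofReal_mul (by positivity), ← ENNReal.ofReal_mul (by positivity)]
            congr 2
            field_simp
            norm_num
    refine ne_top_of_le_ne_top ?_ (lintegral_mono hbd)
    rw [lintegral_const_mul _ hGm]
    exact ENNReal.mul_ne_top ENNReal.ofReal_ne_top hfin
  · intro z
    change ∫⁻ u, K z u ≠ ∞
    rw [hKball]
    exact ENNReal.mul_ne_top ENNReal.ofReal_ne_top
      (ne_top_of_le_ne_top hfin (setLIntegral_le_lintegral _ _))
  · intro z w hw
    have hz := norm_nonneg z
    change _ ≤ ∫⁻ u, K z u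
    rw [hKball]
    have hr : (0 : ℝ) < 1 / (1 + ‖z‖) := by positivity
    have hr2 : 2 / (1 + ‖z‖) = 1 / (1 + ‖z‖) + 1 / (1 + ‖z‖) := by ring
    have hw2 : ‖w - z‖ ≤ 2 / (1 + ‖z‖) := by linarith
    have hsub : Metric.ball w (1 / (1 + ‖z‖)) ⊆ Metric.ball z (2 / (1 + ‖z‖)) := by
      refine Metric.ball_subset_ball' ?_
      rw [dist_eq_norm, hr2]
      linarith
    have hmean := volume_ball_mul_norm_rpow_le hg hp w (1 / (1 + ‖z‖))
    have hW : 0 < fockWeight α k w := fockWeight_pos α k w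
    have hvol : volume (Metric.ball w (1 / (1 + ‖z‖))) =
        ENNReal.ofReal (Real.pi / (1 + ‖z‖) ^ 2) := by
      rw [Complex.volume_ball]
      have : (NNReal.pi : ℝ≥0∞) = ENNReal.ofReal Real.pi := by
        rw [ENNReal.ofReal, ← NNReal.coe_real_pi, Real.toNNReal_coe]
      rw [this, ← ENNReal.ofReal_pow hr.le, ← ENNReal.ofReal_mul (by positivity)]
      congr 1
      field_simp
    rw [hvol] at hmean
    calc ENNReal.ofReal ((‖g w‖ * fockWeight α k w) ^ p)
        = ENNReal.ofReal (fockWeight α k w ^ p * ((1 + ‖z‖) ^ 2 / Real.pi)) *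
          (ENNReal.ofReal (Real.pi / (1 + ‖z‖) ^ 2) * ENNReal.ofReal (‖g w‖ ^ p)) := by
          rw [← ENNReal.ofReal_mul (by positivity), ← ENNReal.ofReal_mul (by positivity),
            Real.mul_rpow (norm_nonneg _) hW.le]
          congr 1
          field_simp
      _ ≤ ENNReal.ofReal (fockWeight α k w ^ p * ((1 + ‖z‖) ^ 2 / Real.pi)) *
          ∫⁻ u in Metric.ball z (2 / (1 + ‖z‖)), ENNReal.ofReal (‖g u‖ ^ p) := by
          gcongr
          exact hmean.trans (lintegral_mono_set hsub)
      _ = ENNReal.ofReal ((1 + ‖z‖) ^ 2 / Real.pi) *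
          ∫⁻ u in Metric.ball z (2 / (1 + ‖z‖)),
            ENNReal.ofReal (fockWeight α k w ^ p * ‖g u‖ ^ p) := by
          simp only [ENNReal.ofReal_mul (Real.rpow_nonneg hW.le p)]
          rw [lintegral_const_mul']
          · ring
          · exact ENNReal.ofReal_ne_top
      _ ≤ ENNReal.ofReal ((1 + ‖z‖) ^ 2 / Real.pi) *
          ∫⁻ u in Metric.ball z (2 / (1 + ‖z‖)), ENNReal.ofReal (C ^ p) * G u := by
          refine mul_le_mul_right ?_ _
          refine setLIntegral_mono (hGm.const_mul _) fun u hu => ?_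
          rw [Metric.mem_ball, dist_eq_norm] at hu
          simp only [G]
          rw [← ENNReal.ofReal_mul (by positivity)]
          refine ENNReal.ofReal_le_ofReal ?_
          have hU := fockWeight_pos α k u
          rw [← Real.mul_rpow hW.le (norm_nonneg _), ← Real.mul_rpow hC.le (by positivity)]
          refine Real.rpow_le_rpow (by positivity) ?_ hp.le
          have := mul_le_mul_of_nonneg_right (hcomp z u w hu.le hw2) (norm_nonneg (g u))
          linarith
      _ = c z * ∫⁻ u in Metric.ball z (2 / (1 + ‖z‖)), G u := by
          rw [lintegral_const_mul _ hGm, ← mul_assoc, ← ENNReal.ofReal_mul (by positivity),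
            mul_comm ((1 + ‖z‖) ^ 2 / Real.pi)]

lemma memLp_iff_lintegral_ofReal_rpow {F : ℂ → ℝ} (hF : AEStronglyMeasurable F volume)
    (h0 : ∀ z, 0 ≤ F z) {p : ℝ≥0∞} (hp : p ≠ 0) (hp' : p ≠ ∞) :
    MemLp F p volume ↔ ∫⁻ z, ENNReal.ofReal (F z ^ p.toReal) ≠ ∞ := by
  have h : ∀ z, ‖F z‖ₑ ^ p.toReal = ENNReal.ofReal (F z ^ p.toReal) := fun z => by
    rw [Real.enorm_eq_ofReal (h0 z), ENNReal.ofReal_rpow_of_nonneg (h0 z) ENNReal.toReal_nonneg]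
  rw [← lt_top_iff_ne_top, MemLp, and_iff_right hF,
    eLpNorm_lt_top_iff_lintegral_rpow_enorm_lt_top hp hp']
  simp only [h]

/-- The set where the essential bound holds is closed and of full measure, hence everything. -/
lemma exists_bound_of_memLp_top {F : ℂ → ℝ} (hF : Continuous F) (h : MemLp F ∞ volume) :
    ∃ K, 0 ≤ K ∧ ∀ z, F z ≤ K := by
  have h1 := h.eLpNorm_ne_top
  refine ⟨(eLpNorm F ∞ volume).toReal, ENNReal.toReal_nonneg, ?_⟩
  have hae : ∀ᵐ z, F z ≤ (eLpNorm F ∞ volume).toReal := by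
    rw [eLpNorm_exponent_top] at h1 ⊢
    filter_upwards [ae_le_eLpNormEssSup (f := F) (μ := volume)] with z hz
    have := ENNReal.toReal_mono h1 hz
    rw [toReal_enorm] at this
    exact (le_abs_self _).trans this
  have hd := Measure.dense_of_ae hae
  have hcl : IsClosed {z | F z ≤ (eLpNorm F ∞ volume).toReal} :=
    isClosed_le hF continuous_const
  intro z
  have := hd z
  rwa [hcl.closure_eq] at this

/-- The local maximal function of a weighted entire function in `L^p` is dominated by a function
in `L^p`. -/
lemma exists_memLp_local_bound {α : ℝ} (hα : 0 < α) (k : ℕ) {p : ℝ≥0∞} (hp : p ≠ 0)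
    {g : ℂ → ℂ} (hg : Differentiable ℂ g)
    (hmem : MemLp (fun z => ‖g z‖ * fockWeight α k z) p volume) :
    ∃ A : ℂ → ℝ, (p ≠ ∞ → MemLp A p volume) ∧ (p = ∞ → ∃ K, ∀ z, A z ≤ K) ∧ (∀ z, 0 ≤ A z) ∧
      ∀ z w, ‖w - z‖ ≤ 1 / (1 + ‖z‖) → ‖g w‖ * fockWeight α k w ≤ A z := by
  have hcont : Continuous fun z => ‖g z‖ * fockWeight α k z :=
    hg.continuous.norm.mul (continuous_fockWeight α k)
  have hnn : ∀ z, 0 ≤ ‖g z‖ * fockWeight α k z := fun z =>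
    mul_nonneg (norm_nonneg _) (fockWeight_pos α k z).le
  rcases eq_or_ne p ∞ with rfl | hp'
  -- For p = ∞ a bound at every point is kept, since it is later evaluated at a maximum point.
  · obtain ⟨K, hK0, hK⟩ := exists_bound_of_memLp_top hcont hmem
    exact ⟨fun _ => K, fun h => (h rfl).elim, fun _ => ⟨K, fun _ => le_rfl⟩, fun _ => hK0,
      fun _ w _ => hK w⟩
  · have hpr : 0 < p.toReal := ENNReal.toReal_pos hp hp'
    rw [memLp_iff_lintegral_ofReal_rpow hcont.aestronglyMeasurable hnn hp hp'] at hmem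
    obtain ⟨A, hAm, hAint, hAfin, hA⟩ := exists_lintegral_local_bound hα k hpr hg hmem
    have hB0 : ∀ z, 0 ≤ (A z).toReal ^ p.toReal⁻¹ := fun z =>
      Real.rpow_nonneg ENNReal.toReal_nonneg _
    have hBp : ∀ z, ((A z).toReal ^ p.toReal⁻¹) ^ p.toReal = (A z).toReal := fun z =>
      Real.rpow_inv_rpow ENNReal.toReal_nonneg hpr.ne'
    refine ⟨fun z => (A z).toReal ^ p.toReal⁻¹, fun _ => ?_, fun h => (hp' h).elim, hB0, ?_⟩
    · rw [memLp_iff_lintegral_ofReal_rpow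
        (hAm.ennreal_toReal.pow_const _).aestronglyMeasurable hB0 hp hp']
      simpa only [hBp, ENNReal.ofReal_toReal (hAfin _)] using hAint
    · intro z w hw
      have h1 := hA z w hw
      rw [ENNReal.ofReal_le_iff_le_toReal (hAfin z)] at h1
      exact (Real.le_rpow_inv_iff_of_pos (hnn w) ENNReal.toReal_nonneg hpr).2 h1

lemma memLp_of_local_bound {p : ℝ≥0∞} {F A : ℂ → ℝ} (hF : Continuous F) (h0 : ∀ z, 0 ≤ F z)
    (hA : p ≠ ∞ → MemLp A p volume) (hA' : p = ∞ → ∃ K, ∀ z, A z ≤ K) {C : ℝ} (hC : 0 ≤ C)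
    (hle : ∀ z, F z ≤ C * A z) : MemLp F p volume := by
  rcases eq_or_ne p ∞ with rfl | hp'
  · obtain ⟨K, hK⟩ := hA' rfl
    refine memLp_top_of_bound hF.aestronglyMeasurable (C * K) (.of_forall fun z => ?_)
    rw [Real.norm_of_nonneg (h0 z)]
    exact (hle z).trans (mul_le_mul_of_nonneg_left (hK z) hC)
  · refine ((hA hp').const_mul C).mono hF.aestronglyMeasurable (.of_forall fun z => ?_)
    rw [Real.norm_of_nonneg (h0 z)]
    exact (hle z).trans (le_abs_self _)

/-! ### From a function to its derivative -/

lemma continuous_norm_mul_fockWeight {α : ℝ} {k : ℕ} {g : ℂ → ℂ} (hg : Differentiable ℂ g) :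
    Continuous fun z => ‖g z‖ * fockWeight α k z :=
  hg.continuous.norm.mul (continuous_fockWeight α k)

lemma differentiable_deriv_of_entire {g : ℂ → ℂ} (hg : Differentiable ℂ g) :
    Differentiable ℂ (deriv g) := fun z => (hg.analyticAt z).deriv.differentiableAt

/-- Cauchy's estimate turns a weighted `L^p` bound on `g` into one on `g'`. -/
lemma memLp_deriv_of_memLp {α : ℝ} (hα : 0 < α) (k : ℕ) {p : ℝ≥0∞} (hp : p ≠ 0)
    {g : ℂ → ℂ} (hg : Differentiable ℂ g)
    (hmem : MemLp (fun z => ‖g z‖ * fockWeight α k z) p volume) :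
    MemLp (fun z => ‖deriv g z‖ * fockWeight α (k + 1) z) p volume := by
  obtain ⟨C, hC, hcomp⟩ := fockWeight_comparable hα k
  obtain ⟨A, hA1, hA2, hA0, hA⟩ := exists_memLp_local_bound hα k hp hg hmem
  refine memLp_of_local_bound (continuous_norm_mul_fockWeight (differentiable_deriv_of_entire hg))
    (fun z => mul_nonneg (norm_nonneg _) (fockWeight_pos α _ z).le) hA1 hA2 hC.le fun z => ?_
  have hz := norm_nonneg z
  have hW := fockWeight_pos α k z
  have hr : 0 < 1 / (1 + ‖z‖) := by positivity
  have hr2 : 2 / (1 + ‖z‖) = 1 / (1 + ‖z‖) + 1 / (1 + ‖z‖) := by ring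
  -- Dividing by the radius 1/(1+|z|) costs exactly the factor that the weight of index k + 1
  -- supplies.
  have hd := Complex.norm_deriv_le_of_forall_mem_sphere_norm_le (f := g) (c := z)
    (C := C * A z / fockWeight α k z) hr hg.diffContOnCl fun w hw => by
      rw [mem_sphere_iff_norm] at hw
      have hW' := fockWeight_pos α k w
      have h1 := hA z w hw.le
      have h2 := hcomp z w z (by linarith) (by rw [sub_self, norm_zero]; linarith)
      rw [le_div_iff₀ hW]
      calc ‖g w‖ * fockWeight α k z ≤ ‖g w‖ * (C * fockWeight α k w) := by gcongr
        _ = C * (‖g w‖ * fockWeight α k w) := by ring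
        _ ≤ C * A z := by gcongr
  calc ‖deriv g z‖ * fockWeight α (k + 1) z
      ≤ C * A z / fockWeight α k z / (1 / (1 + ‖z‖)) * fockWeight α (k + 1) z :=
        mul_le_mul_of_nonneg_right hd (fockWeight_pos α _ z).le
    _ = C * A z := by
        rw [fockWeight_succ]
        field_simp

/-! ### From the derivative back to the function -/

lemma ENNReal.le_of_le_mul_add {I c K : ℝ≥0∞} (hc : c < 1) (hI : I ≠ ∞) (h : I ≤ c * I + K) :
    I ≤ K / (1 - c) := by
  have hc' : 1 - c ≠ 0 := (tsub_pos_of_lt hc).ne'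
  rw [ENNReal.le_div_iff_mul_le (Or.inl hc') (Or.inl (by simp)),
    ENNReal.mul_sub (fun _ _ => hI), mul_one, mul_comm]
  exact tsub_le_iff_left.2 h

/-- A continuous function that contracts along `radialShift` up to an `L^p` error lies in
`L^p`. -/
lemma memLp_of_le_radialShift {p : ℝ≥0∞} (hp : p ≠ 0) {F A : ℂ → ℝ} (hF : Continuous F)
    (h0 : ∀ z, 0 ≤ F z) (hA0 : ∀ z, 0 ≤ A z)
    (hA : p ≠ ∞ → MemLp A p volume) (hA' : p = ∞ → ∃ K, ∀ z, A z ≤ K) {q : ℝ} (hq0 : 0 ≤ q)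
    (hq1 : q < 1) (hle : ∀ z, 1 ≤ ‖z‖ → F z ≤ q * F (radialShift z) + A z) :
    MemLp F p volume := by
  obtain ⟨B, hB⟩ := (isCompact_closedBall (0 : ℂ) 1).exists_bound_of_continuousOn hF.continuousOn
  have hB1 : ∀ z : ℂ, ‖z‖ ≤ 1 → F z ≤ B := fun z hz =>
    (le_abs_self _).trans (hB z (mem_closedBall_zero_iff.2 hz))
  have hB0 : 0 ≤ B := (h0 0).trans (hB1 0 (by simp))
  rcases eq_or_ne p ∞ with rfl | hp'
  · obtain ⟨K, hK⟩ := hA' rfl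
    have hK0 : 0 ≤ K := (hA0 0).trans (hK 0)
    refine memLp_top_of_bound hF.aestronglyMeasurable (max B (K / (1 - q)))
      (.of_forall fun z => ?_)
    rw [Real.norm_of_nonneg (h0 z)]
    -- The shift stays in this ball, so at a maximum point outside the unit disc F ≤ qF + K.
    obtain ⟨z₀, hz₀, hmax⟩ := (isCompact_closedBall (0 : ℂ) ‖z‖).exists_isMaxOn
      ⟨0, by simp⟩ hF.continuousOn
    rw [mem_closedBall_zero_iff] at hz₀
    have hzz : F z ≤ F z₀ := hmax (by simp)
    refine hzz.trans ?_
    rcases le_total ‖z₀‖ 1 with h1 | h1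
    · exact (hB1 z₀ h1).trans (le_max_left _ _)
    · refine le_trans ?_ (le_max_right _ _)
      have h2 : F (radialShift z₀) ≤ F z₀ :=
        hmax (mem_closedBall_zero_iff.2 ((norm_radialShift_le h1).trans hz₀))
      rw [le_div_iff₀ (by linarith)]
      nlinarith [hle z₀ h1, hK z₀]
  have hpr : 0 < p.toReal := ENNReal.toReal_pos hp hp'
  have hAp := hA hp'
  have hAint := (memLp_iff_lintegral_ofReal_rpow hAp.1 hA0 hp hp').1 hAp
  rw [memLp_iff_lintegral_ofReal_rpow hF.aestronglyMeasurable h0 hp hp']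
  set s := p.toReal
  -- Room between q and 1 replaces any inequality for (a + b)^s: either A is small and F ≤ r F(z'),
  -- or A dominates and F ≤ D A. This treats s < 1 and s ≥ 1 alike.
  obtain ⟨r, hqr, hr1⟩ := exists_between hq1
  have hr0 : 0 ≤ r := hq0.trans hqr.le
  set D := r / (r - q) with hD
  have hD0 : 0 ≤ D := div_nonneg hr0 (by linarith)
  have hmax : ∀ z, 1 ≤ ‖z‖ → F z ^ s ≤ r ^ s * F (radialShift z) ^ s + D ^ s * A z ^ s := by
    intro z hz
    have h1 := hle z hz
    have hx := h0 (radialShift z)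
    have ha := hA0 z
    rcases le_total (A z) ((r - q) * F (radialShift z)) with h2 | h2
    · have h3 : F z ^ s ≤ (r * F (radialShift z)) ^ s :=
        Real.rpow_le_rpow (h0 z) (by linarith) hpr.le
      rw [Real.mul_rpow hr0 hx] at h3
      have : 0 ≤ D ^ s * A z ^ s := by positivity
      linarith
    · have h4 : F (radialShift z) ≤ A z / (r - q) := by
        rw [le_div_iff₀ (by linarith)]; linarith
      have h5 : F z ≤ D * A z := by
        refine h1.trans ((add_le_add_left (mul_le_mul_of_nonneg_left h4 hq0) _).trans_eq ?_)
        rw [hD]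
        have : r - q ≠ 0 := by linarith
        field_simp
        ring
      have h3 := Real.rpow_le_rpow (h0 z) h5 hpr.le
      rw [Real.mul_rpow hD0 ha] at h3
      have : 0 ≤ r ^ s * F (radialShift z) ^ s := by positivity
      linarith
  set Φ : ℂ → ℝ≥0∞ := fun z => ENNReal.ofReal (F z ^ s) with hΦ
  have hΦc : Continuous fun z => F z ^ s := hF.rpow_const fun _ => Or.inr hpr.le
  have hΦm : Measurable Φ := (ENNReal.continuous_ofReal.comp hΦc).measurable
  -- Absorbing needs a finite integral, hence the truncation to balls, which the shift maps into
  -- themselves outside the unit disc.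
  set I : ℕ → ℝ≥0∞ := fun n => ∫⁻ z in Metric.ball (0 : ℂ) n, Φ z with hI
  have hIfin : ∀ n, I n ≠ ∞ := by
    intro n
    obtain ⟨M, hM⟩ := (isCompact_closedBall (0 : ℂ) n).exists_bound_of_continuousOn
      hΦc.continuousOn
    have : I n ≤ ∫⁻ z in Metric.ball (0 : ℂ) n, ENNReal.ofReal M := by
      refine setLIntegral_mono measurable_const fun z hz => ENNReal.ofReal_le_ofReal ?_
      exact (le_abs_self _).trans (hM z (Metric.ball_subset_closedBall hz))
    refine ne_top_of_le_ne_top ?_ this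
    rw [setLIntegral_const]
    exact ENNReal.mul_ne_top ENNReal.ofReal_ne_top measure_ball_lt_top.ne
  set K : ℝ≥0∞ := ENNReal.ofReal (B ^ s) * volume (Metric.closedBall (0 : ℂ) 1) +
    ENNReal.ofReal (D ^ s) * ∫⁻ z, ENNReal.ofReal (A z ^ s) with hK
  have hKfin : K ≠ ∞ := ENNReal.add_ne_top.2
    ⟨ENNReal.mul_ne_top ENNReal.ofReal_ne_top measure_closedBall_lt_top.ne,
      ENNReal.mul_ne_top ENNReal.ofReal_ne_top hAint⟩
  have hset : MeasurableSet {z : ℂ | 1 ≤ ‖z‖} :=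
    measurableSet_le measurable_const measurable_norm
  have hrec : ∀ n, I n ≤ ENNReal.ofReal (r ^ s) * I n + K := by
    intro n
    set Ψ : ℂ → ℝ≥0∞ := (Metric.ball (0 : ℂ) n).indicator Φ with hΨ
    have hΨm : Measurable Ψ := hΦm.indicator measurableSet_ball
    have hIΨ : I n = ∫⁻ z, Ψ z := (lintegral_indicator measurableSet_ball _).symm
    have hpt : ∀ z, Ψ z ≤ ENNReal.ofReal (r ^ s) *
        {z : ℂ | 1 ≤ ‖z‖}.indicator (fun z => Ψ (radialShift z)) z +
        ((Metric.closedBall (0 : ℂ) 1).indicator (fun _ => ENNReal.ofReal (B ^ s)) z +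
        ENNReal.ofReal (D ^ s) * ENNReal.ofReal (A z ^ s)) := by
      intro z
      by_cases hz : z ∈ Metric.ball (0 : ℂ) n
      · rw [hΨ, Set.indicator_of_mem hz, ← hΨ]
        rcases le_total ‖z‖ 1 with h1 | h1
        · refine le_trans ?_ le_add_self
          refine le_trans ?_ le_self_add
          rw [Set.indicator_of_mem (mem_closedBall_zero_iff.2 h1)]
          exact ENNReal.ofReal_le_ofReal (Real.rpow_le_rpow (h0 z) (hB1 z h1) hpr.le)
        · have hs : radialShift z ∈ Metric.ball (0 : ℂ) n := by
            rw [mem_ball_zero_iff] at hz ⊢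
            exact (norm_radialShift_le h1).trans_lt hz
          rw [Set.indicator_of_mem (s := {z : ℂ | 1 ≤ ‖z‖}) h1, hΨ, Set.indicator_of_mem hs]
          refine le_trans ?_ (add_le_add_right le_add_self _)
          simp only [hΦ]
          have hx := h0 (radialShift z)
          rw [← ENNReal.ofReal_mul (by positivity), ← ENNReal.ofReal_mul (by positivity),
            ← ENNReal.ofReal_add (by positivity)
              (mul_nonneg (by positivity) (Real.rpow_nonneg (hA0 z) _))]
          exact ENNReal.ofReal_le_ofReal (hmax z h1)
      · rw [hΨ, Set.indicator_of_notMem hz]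
        exact zero_le
    have hshift : Measurable fun z => Ψ (radialShift z) := hΨm.comp measurable_radialShift
    calc I n = ∫⁻ z, Ψ z := hIΨ
      _ ≤ _ := lintegral_mono hpt
      _ = ENNReal.ofReal (r ^ s) * (∫⁻ z in {z : ℂ | 1 ≤ ‖z‖}, Ψ (radialShift z)) + K := by
          rw [lintegral_add_left ((hshift.indicator hset).const_mul _),
            lintegral_add_left (measurable_const.indicator measurableSet_closedBall),
            lintegral_const_mul _ (hshift.indicator hset), lintegral_indicator hset,
            lintegral_indicator_const measurableSet_closedBall,
            lintegral_const_mul' _ _ ENNReal.ofReal_ne_top]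
      _ ≤ ENNReal.ofReal (r ^ s) * I n + K := by
          rw [hIΨ]
          exact add_le_add_left (mul_le_mul_right (lintegral_comp_radialShift_le hΨm) _) _
  have hc1 : ENNReal.ofReal (r ^ s) < 1 := by
    rw [ENNReal.ofReal_lt_one]
    exact Real.rpow_lt_one hr0 hr1 hpr
  have hbound : ∀ n, I n ≤ K / (1 - ENNReal.ofReal (r ^ s)) := fun n =>
    ENNReal.le_of_le_mul_add hc1 (hIfin n) (hrec n)
  have hdir : Directed (· ⊆ ·) fun n : ℕ => Metric.ball (0 : ℂ) n :=
    Monotone.directed_le fun m n h => Metric.ball_subset_ball (by exact_mod_cast h)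
  have hsup : ∫⁻ z, Φ z = ⨆ n, I n := by
    rw [← setLIntegral_univ, ← Metric.iUnion_ball_nat (0 : ℂ)]
    exact setLIntegral_iUnion_of_directed _ hdir
  change ∫⁻ z, Φ z ≠ ∞
  rw [hsup]
  refine ne_top_of_le_ne_top ?_ (iSup_le hbound)
  exact ENNReal.div_ne_top hKfin (tsub_pos_of_lt hc1).ne'

/-- A weighted `L^p` bound on `g'` gives one on `g`. -/
lemma memLp_of_memLp_deriv {α : ℝ} (hα : 0 < α) (k : ℕ) {p : ℝ≥0∞} (hp : p ≠ 0)
    {g : ℂ → ℂ} (hg : Differentiable ℂ g)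
    (hmem : MemLp (fun z => ‖deriv g z‖ * fockWeight α (k + 1) z) p volume) :
    MemLp (fun z => ‖g z‖ * fockWeight α k z) p volume := by
  obtain ⟨A, hA1, hA2, hA0, hA⟩ :=
    exists_memLp_local_bound hα (k + 1) hp (differentiable_deriv_of_entire hg) hmem
  refine memLp_of_le_radialShift hp (continuous_norm_mul_fockWeight hg)
    (fun z => mul_nonneg (norm_nonneg _) (fockWeight_pos α _ z).le) hA0 hA1 hA2
    (Real.exp_pos (-(α / 4))).le (Real.exp_lt_one_iff.2 (by linarith)) fun z hz => ?_
  have hW := fockWeight_pos α k z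
  have hW1 := fockWeight_pos α (k + 1) z
  -- The first bound makes the weight at w at least that at z; the second lets `A z` control g' at
  -- w.
  have hseg : ∀ w ∈ segment ℝ (radialShift z) z, ‖w‖ ≤ ‖z‖ ∧ ‖w - z‖ ≤ 1 / (1 + ‖z‖) := by
    intro w hw
    constructor
    · have := (convex_closedBall (0 : ℂ) ‖z‖).segment_subset
        (mem_closedBall_zero_iff.2 (norm_radialShift_le hz)) (by simp) hw
      exact mem_closedBall_zero_iff.1 this
    · have := (convex_closedBall z (1 / (1 + ‖z‖))).segment_subset
        (mem_closedBall_iff_norm.2 (norm_radialShift_sub_le hz))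
        (Metric.mem_closedBall_self (by positivity)) hw
      exact mem_closedBall_iff_norm.1 this
  have hmv := (convex_segment (radialShift z) z).norm_image_sub_le_of_norm_deriv_le
    (f := g) (C := A z / fockWeight α (k + 1) z) (fun w _ => hg w)
    (fun w hw => by
      rw [le_div_iff₀ hW1]
      refine le_trans ?_ (hA z w (hseg w hw).2)
      gcongr
      exact fockWeight_anti hα _ (hseg w hw).1)
    (left_mem_segment ℝ _ _) (right_mem_segment ℝ _ _)
  rw [norm_sub_rev z] at hmv
  have h1 : ‖g z‖ ≤ ‖g (radialShift z)‖ + A z / fockWeight α (k + 1) z * (1 / (1 + ‖z‖)) := by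
    have h2 := norm_le_norm_add_norm_sub' (g z) (g (radialShift z))
    have h3 := mul_le_mul_of_nonneg_left (norm_radialShift_sub_le hz)
      (div_nonneg (hA0 z) hW1.le)
    linarith
  calc ‖g z‖ * fockWeight α k z
      ≤ (‖g (radialShift z)‖ + A z / fockWeight α (k + 1) z * (1 / (1 + ‖z‖))) *
        fockWeight α k z := by gcongr
    _ = ‖g (radialShift z)‖ * fockWeight α k z + A z := by
        rw [add_mul, fockWeight_succ]
        have : 1 + ‖z‖ ≠ 0 := by positivity
        field_simp
    _ ≤ ‖g (radialShift z)‖ * (Real.exp (-(α / 4)) * fockWeight α k (radialShift z)) + A z := by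
        gcongr
        exact fockWeight_le_radialShift k hz
    _ = _ := by ring

/-! ### Higher derivatives and the theorem -/

lemma differentiable_iteratedDeriv {f : ℂ → ℂ} (hf : Differentiable ℂ f) (n : ℕ) :
    Differentiable ℂ (iteratedDeriv n f) := by
  induction n with
  | zero => simpa using hf
  | succ n ih => rw [iteratedDeriv_succ]; exact differentiable_deriv_of_entire ih

lemma memLp_iteratedDeriv_iff {α : ℝ} (hα : 0 < α) {p : ℝ≥0∞} (hp : p ≠ 0) {f : ℂ → ℂ}
    (hf : Differentiable ℂ f) (n : ℕ) :
    MemLp (fun z => ‖f z‖ * fockWeight α 0 z) p volume ↔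
      MemLp (fun z => ‖iteratedDeriv n f z‖ * fockWeight α n z) p volume := by
  induction n with
  | zero => simp
  | succ n ih =>
    rw [ih, iteratedDeriv_succ]
    exact ⟨memLp_deriv_of_memLp hα n hp (differentiable_iteratedDeriv hf n),
      memLp_of_memLp_deriv hα n hp (differentiable_iteratedDeriv hf n)⟩

lemma div_mem_weightedLp_iff {α : ℝ} {p : ℝ≥0∞} {g : ℂ → ℂ} (hg : Continuous g) (k : ℕ) :
    (fun z : ℂ => g z / (((1 + ‖z‖) ^ k : ℝ) : ℂ)) ∈ weightedLp p α ↔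
      MemLp (fun z => ‖g z‖ * fockWeight α k z) p volume := by
  have hne : ∀ z : ℂ, (((1 + ‖z‖) ^ k : ℝ) : ℂ) ≠ 0 := fun z => by
    have : (1 + ‖z‖) ^ k ≠ 0 := by positivity
    exact_mod_cast this
  have hc : Continuous fun z : ℂ => g z / (((1 + ‖z‖) ^ k : ℝ) : ℂ) *
      ((Real.exp (-(α * ‖z‖ ^ 2 / 2)) : ℝ) : ℂ) := by
    refine (hg.div ?_ hne).mul ?_ <;> fun_prop
  refine memLp_congr_norm hc.aestronglyMeasurable
    (hg.norm.mul (continuous_fockWeight α k)).aestronglyMeasurable (.of_forall fun z => ?_)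
  have h1 : 0 ≤ (1 + ‖z‖) ^ k := by positivity
  simp only [norm_mul, norm_div, Complex.norm_real, norm_norm, fockWeight,
    Real.norm_of_nonneg h1, Real.norm_of_nonneg (Real.exp_pos _).le]
  ring

theorem theorem11 (α : ℝ) (hα : 0 < α) (p : ℝ≥0∞) (hp : 0 < p) (N : ℕ) (hN : 1 ≤ N)
    (f : ℂ → ℂ) (hf : f ∈ entireFunctions) :
    f ∈ fockSpace p α ↔
      (fun z : ℂ => iteratedDeriv N f z / (((1 + ‖z‖) ^ N : ℝ) : ℂ)) ∈ weightedLp p α := by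
  have hd : Differentiable ℂ f := hf
  have h0 := div_mem_weightedLp_iff (α := α) (p := p) hd.continuous 0
  simp only [pow_zero, Complex.ofReal_one, div_one] at h0
  rw [div_mem_weightedLp_iff (differentiable_iteratedDeriv hd N).continuous,
    ← memLp_iteratedDeriv_iff hα hp.ne' hd, ← h0]
  exact and_iff_left hf
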